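/- Let $\mathbb F_q$ be the finite field with $q$ elements, $n\ge 2$, and let $N:\mathbb F_{q^n}\to\mathbb F_q$ be the norm map $N(X)=\prod_{i=0}^{n-1}X^{q^i}$ (so $N(0)=0$). Let $t$ be fixed. For a set $S$ of pairs $(i,j)$ with $1\le i<j\le t$, a set $\mathcal A\subseteq\mathbb F_{q^n}$ and elements $\lambda_{ij}\in\mathbb F_q$, consider the system of $l=|S|\le\binom t2$ norm equations $$N(X_i+X_j)=\lambda_{ij}\quad((i,j)\in S),\qquad X_1,\dots,X_t\in\mathcal A. \tag{1}$$ (a) Let $S$ consist of all $\binom t2$ pairs. If $|\mathcal A|\gg q^{(n+t)/2}$, then (1) is solvable for at least $(1-o(1))\,q^{\binom t2}$ choices of $(\lambda_{ij})_{1\le i<j\le t}\in\mathbb F_q^{\binom t2}$. (b) Suppose that each variable appears in at most $k\le t-1$ of the equations of (1), and that $|\mathcal A|\gg q^{n/2+t-1}$. Then for any $\lambda_{ij}\in\mathbb F_q^{*}$, the system (1) has $(1+o(1))\,q^{-l}|\mathcal A|^t$ solutions $(X_1,\dots,X_t)\in\mathcal A^t$. Here $X\gg Y$ means $Y=o(X)$,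 and all asymptotics are for $q\to\infty$ with $t$ fixed, uniformly in everything else. Explicitly: for every $t$ and every $\varepsilon>0$ there are $C>0$ and $q_0$ such that for all prime powers $q\ge q_0$, all $n\ge2$ and all $\mathcal A\subseteq\mathbb F_{q^n}$: in (a), if $|\mathcal A|\ge C q^{(n+t)/2}$, the number of choices of $(\lambda_{ij})$ for which (1) is solvable is at least $(1-\varepsilon)q^{\binom t2}$; in (b), if $|\mathcal A|\ge C q^{n/2+t-1}$, then for every such $S$ and all $\lambda_{ij}\in\mathbb F_q^*$ the number of solutions differs from $q^{-l}|\mathcal A|^t$ by at most $\varepsilon\, q^{-l}|\mathcal A|^t$. -/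

import Mathlib

universe u v

/-- Index pairs `(i, j)` with `i < j`, for `t` variables. -/
abbrev IndexPair (t : ℕ) : Type := {p : Fin t × Fin t // p.1 < p.2}

/-- `X = (X_1, …, X_t)` solves the system `N(X_i + X_j) = lam_{ij}` (one equation for each pair
`(i, j) ∈ S`), with all variables `X_i` taken from `A`. Here `N` is the norm of `K / F`. -/
def SolvesNormSystem (F : Type*) {K : Type*} [Field F] [Field K] [Algebra F K] {t : ℕ}
    (A : Finset K) (S : Finset (IndexPair t)) (lam : IndexPair t → F) (X : Fin t → K) : Prop :=
  (∀ i, X i ∈ A) ∧ ∀ p ∈ S, Algebra.norm F (X p.1.1 + X p.1.2) = lam p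

/-- The number of equations of the system indexed by `S` in which the variable `X_i` appears. -/
def occurrences {t : ℕ} (S : Finset (IndexPair t)) (i : Fin t) : ℕ :=
  (S.filter fun p => p.1.1 = i ∨ p.1.2 = i).card

/-- The number of solutions of the norm system indexed by `S` with variables in `A`. -/
noncomputable def numSolutions (F : Type*) {K : Type*} [Field F] [Field K] [Algebra F K] {t : ℕ}
    (A : Finset K) (S : Finset (IndexPair t)) (lam : IndexPair t → F) : ℕ :=
  {X : Fin t → K | SolvesNormSystem F A S lam X}.ncard

/-- The number of choices of right-hand sides `lam_{ij} ∈ F`, `i < j`, for which the system of all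
`t choose 2` norm equations is solvable with variables in `A`. -/
noncomputable def numSolvable (F : Type*) {K : Type*} [Field F] [Field K] [Algebra F K] (t : ℕ)
    (A : Finset K) : ℕ :=
  {lam : IndexPair t → F | ∃ X : Fin t → K, SolvesNormSystem F A Finset.univ lam X}.ncard

/-! ### Counting solutions of systems of pseudo-random binary constraints. -/

section Counting

open Finset
open scoped Classical

variable {V : Type*} {t : ℕ}

/-! The engine is a counting lemma, `abs_card_constrainedTuples_sub_le`. Write N(S) for the number
of points of A^t satisfying the constraints in S. To remove a pair e = (i, j), freeze the
coordinates other than i and j: the remaining constraints split into a set U of values for X_i and a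
set W for X_j, because only e links the two. If the relation of e has density δ with error
Λ√(|U||W|), summing over the frozen coordinates and using Cauchy–Schwarz compares N(S) with δ N(S \
{e}). The error involves the counts for S with all pairs through i, or all pairs through j, deleted.
Induction bounds those; at most t - 1 pairs are lost, so the relative error is O(Λ q^(t-1) / |A|).

Pseudo-randomness comes from characters: for χ ≠ 1 on F, ψ = χ ∘ N is nontrivial on K, and the
matrix ψ(x + y) has operator norm at most √|K|. Expanding N(x + y) = c, c ≠ 0, in characters gives Λ
= q^(n/2), hence (b).

For (a), the relation N(x + y) = N(x' + y') on K × K has Λ = 4q^n. The counting lemma over A × A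
bounds the number of pairs of tuples with equal norm vectors, and Cauchy–Schwarz turns this second
moment into a lower bound for the number of norm vectors attained. -/

/-- The points of `A ^ t` satisfying the binary constraint `R p` for every index pair `p ∈ S`. -/
noncomputable def constrainedTuples (A : Finset V) (R : IndexPair t → V → V → Prop)
    (S : Finset (IndexPair t)) : Finset (Fin t → V) :=
  (Fintype.piFinset fun _ => A).filter fun X => ∀ p ∈ S, R p (X p.1.1) (X p.1.2)

/-- The pairs of `S` that do not involve the index `i`. -/
def deleteStar (S : Finset (IndexPair t)) (i : Fin t) : Finset (IndexPair t) :=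
  S.filter fun p => ¬(p.1.1 = i ∨ p.1.2 = i)

/-- Swapping x with the i-th coordinate of X is an involution of A^t × A. It serves to resample a
coordinate at the cost of a factor `#A`. -/
lemma sum_sum_update {M : Type*} [AddCommMonoid M] (A : Finset V) (i : Fin t)
    (f : (Fin t → V) → M) :
    ∑ X ∈ Fintype.piFinset (fun _ => A), ∑ x ∈ A, f (Function.update X i x) =
      #A • ∑ X ∈ Fintype.piFinset (fun _ : Fin t => A), f X := by
  have h : ∑ X ∈ Fintype.piFinset (fun _ : Fin t => A), ∑ _x ∈ A, f X =
      #A • ∑ X ∈ Fintype.piFinset (fun _ : Fin t => A), f X := by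
    simp [Finset.smul_sum]
  rw [← h, ← Finset.sum_product', ← Finset.sum_product']
  refine Finset.sum_nbij' (fun z => (Function.update z.1 i z.2, z.1 i))
    (fun z => (Function.update z.1 i z.2, z.1 i)) ?_ ?_ ?_ ?_ ?_
  · rintro ⟨X, x⟩ h
    simp only [mem_product, Fintype.mem_piFinset] at h ⊢
    refine ⟨fun j => ?_, h.1 i⟩
    by_cases hj : j = i
    · subst hj; simpa using h.2
    · simpa [hj] using h.1 j
  · rintro ⟨X, x⟩ h
    simp only [mem_product, Fintype.mem_piFinset] at h ⊢
    refine ⟨fun j => ?_, h.1 i⟩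
    by_cases hj : j = i
    · subst hj; simpa using h.2
    · simpa [hj] using h.1 j
  · rintro ⟨X, x⟩ -; simp
  · rintro ⟨X, x⟩ -; simp
  · rintro ⟨X, x⟩ -; simp

/-- A pair through i is determined by its other endpoint, one of t - 1 indices. -/
lemma occurrences_lt (S : Finset (IndexPair t)) (i : Fin t) :
    occurrences S i < t := by
  have h : occurrences S i ≤ #(univ.erase i) := by
    refine Finset.card_le_card_of_injOn (fun p => if p.1.1 = i then p.1.2 else p.1.1) ?_ ?_
    · rintro ⟨⟨a, b⟩, hab⟩ h
      simp only [coe_filter, Set.mem_ofPred_eq] at h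
      simp only at hab
      simp only [coe_erase, coe_univ, Set.mem_sdiff, Set.mem_univ, Set.mem_singleton_iff, true_and]
      split_ifs with h1
      · rintro rfl; subst h1; exact lt_irrefl _ hab
      · exact h1
    · rintro ⟨⟨a, b⟩, hab⟩ h ⟨⟨c, d⟩, hcd⟩ h' e
      simp only [coe_filter, Set.mem_ofPred_eq] at h h' hab hcd e
      simp only [Subtype.mk.injEq, Prod.mk.injEq]
      grind
  have : 0 < t := i.pos
  simp at h
  omega

lemma card_deleteStar (S : Finset (IndexPair t)) (i : Fin t) :
    #(deleteStar S i) + occurrences S i = #S := by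
  rw [add_comm]
  exact Finset.card_filter_add_card_filter_not _

lemma deleteStar_subset_erase {S : Finset (IndexPair t)} {e : IndexPair t} {i : Fin t}
    (hi : e.1.1 = i ∨ e.1.2 = i) : deleteStar S i ⊆ S.erase e := by
  intro p hp
  simp only [deleteStar, mem_filter] at hp
  refine mem_erase.2 ⟨?_, hp.1⟩
  rintro rfl
  exact hp.2 hi

/-- The decoupling: e is the only pair containing both of its endpoints, so any other constraint
sees at most one of x and y. Constraints avoiding both endpoints occur on both sides of the
conjunction, harmlessly. -/
lemma update_update_satisfies_iff (R : IndexPair t → V → V → Prop) (S : Finset (IndexPair t))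
    (e : IndexPair t) (X : Fin t → V) (x y : V) :
    (∀ p ∈ S.erase e, R p (Function.update (Function.update X e.1.1 x) e.1.2 y p.1.1)
        (Function.update (Function.update X e.1.1 x) e.1.2 y p.1.2)) ↔
      (∀ p ∈ deleteStar S e.1.2, R p (Function.update X e.1.1 x p.1.1)
        (Function.update X e.1.1 x p.1.2)) ∧
      (∀ p ∈ deleteStar S e.1.1, R p (Function.update X e.1.2 y p.1.1)
        (Function.update X e.1.2 y p.1.2)) := by
  obtain ⟨⟨i, j⟩, hij⟩ := e
  simp only at hij
  have hne : i ≠ j := hij.ne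
  have key1 : ∀ k, k ≠ j → Function.update (Function.update X i x) j y k =
      Function.update X i x k := fun k hk => by simp [hk]
  have key2 : ∀ k, k ≠ i → Function.update (Function.update X i x) j y k =
      Function.update X j y k := fun k hk => by
    rw [Function.update_comm hne]; simp [hk]
  constructor
  · intro h
    constructor
    · intro p hp
      have h1 := h p (deleteStar_subset_erase (Or.inr rfl) hp)
      simp only [deleteStar, mem_filter, not_or] at hp
      rwa [key1 _ hp.2.1, key1 _ hp.2.2] at h1
    · intro p hp
      have h1 := h p (deleteStar_subset_erase (Or.inl rfl) hp)
      simp only [deleteStar, mem_filter, not_or] at hp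
      rwa [key2 _ hp.2.1, key2 _ hp.2.2] at h1
  · rintro ⟨h1, h2⟩ p hp
    rw [mem_erase] at hp
    by_cases hj : p.1.1 = j ∨ p.1.2 = j
    · have hi : ¬(p.1.1 = i ∨ p.1.2 = i) := by
        intro hi
        apply hp.1
        obtain ⟨⟨a, b⟩, hab⟩ := p
        simp only at hi hj hab
        simp only [Subtype.mk.injEq, Prod.mk.injEq]
        grind
      have h3 := h2 p (by simp only [deleteStar, mem_filter]; exact ⟨hp.2, hi⟩)
      rw [not_or] at hi
      rwa [key2 _ hi.1, key2 _ hi.2]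
    · have h3 := h1 p (by simp only [deleteStar, mem_filter]; exact ⟨hp.2, hj⟩)
      rw [not_or] at hj
      rwa [key1 _ hj.1, key1 _ hj.2]

/-- The values of the coordinate `i` which, the other coordinates being those of `X`, satisfy
the constraints in `S`. -/
noncomputable def admissible (A : Finset V) (R : IndexPair t → V → V → Prop)
    (S : Finset (IndexPair t)) (X : Fin t → V) (i : Fin t) : Finset V :=
  A.filter fun x => ∀ p ∈ S, R p (Function.update X i x p.1.1) (Function.update X i x p.1.2)

lemma sum_card_admissible (A : Finset V) (R : IndexPair t → V → V → Prop)
    (S : Finset (IndexPair t)) (i : Fin t) :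
    ∑ X ∈ Fintype.piFinset (fun _ => A), (#(admissible A R S X i) : ℝ) =
      #A * #(constrainedTuples A R S) := by
  have := sum_sum_update (M := ℝ) A i
    fun X => if ∀ p ∈ S, R p (X p.1.1) (X p.1.2) then 1 else 0
  simpa [admissible, constrainedTuples] using this

/-- Resampling both endpoints of e produces the two factors `#A`; by decoupling, the admissible (x,
y) for a fixed X form a product set. -/
lemma card_constrainedTuples_erase (A : Finset V) (R : IndexPair t → V → V → Prop)
    (S : Finset (IndexPair t)) (e : IndexPair t) :
    (#A : ℝ) * (#A * #(constrainedTuples A R (S.erase e))) =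
      ∑ X ∈ Fintype.piFinset (fun _ => A), (#(admissible A R (deleteStar S e.1.2) X e.1.1) : ℝ) *
        #(admissible A R (deleteStar S e.1.1) X e.1.2) := by
  have h1 := sum_sum_update (M := ℝ) A e.1.2
    fun X => if ∀ p ∈ S.erase e, R p (X p.1.1) (X p.1.2) then 1 else 0
  have h2 := sum_sum_update (M := ℝ) A e.1.1 fun X => ∑ y ∈ A,
    if ∀ p ∈ S.erase e, R p (Function.update X e.1.2 y p.1.1) (Function.update X e.1.2 y p.1.2)
      then 1 else 0
  rw [h1, Finset.sum_boole] at h2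
  rw [constrainedTuples]
  simp only [nsmul_eq_mul] at h2
  rw [← h2]
  refine Finset.sum_congr rfl fun X _ => ?_
  simp only [update_update_satisfies_iff, ite_and, admissible]
  rw [← Finset.sum_boole, ← Finset.sum_boole, Finset.sum_mul_sum]
  refine Finset.sum_congr rfl fun x _ => Finset.sum_congr rfl fun y _ => ?_
  split_ifs <;> simp

lemma card_constrainedTuples_eq (A : Finset V) (R : IndexPair t → V → V → Prop)
    (S : Finset (IndexPair t)) {e : IndexPair t} (he : e ∈ S) :
    (#A : ℝ) * (#A * #(constrainedTuples A R S)) =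
      ∑ X ∈ Fintype.piFinset (fun _ => A),
        ∑ x ∈ admissible A R (deleteStar S e.1.2) X e.1.1,
          ∑ y ∈ admissible A R (deleteStar S e.1.1) X e.1.2, if R e x y then (1 : ℝ) else 0 := by
  have h1 := sum_sum_update (M := ℝ) A e.1.2
    fun X => if ∀ p ∈ S, R p (X p.1.1) (X p.1.2) then 1 else 0
  have h2 := sum_sum_update (M := ℝ) A e.1.1 fun X => ∑ y ∈ A,
    if ∀ p ∈ S, R p (Function.update X e.1.2 y p.1.1) (Function.update X e.1.2 y p.1.2)
      then 1 else 0
  rw [h1, Finset.sum_boole] at h2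
  rw [constrainedTuples]
  simp only [nsmul_eq_mul] at h2
  rw [← h2]
  refine Finset.sum_congr rfl fun X _ => ?_
  simp only [admissible, Finset.sum_filter]
  refine Finset.sum_congr rfl fun x _ => ?_
  have hS : ∀ y, (∀ p ∈ S, R p (Function.update (Function.update X e.1.1 x) e.1.2 y p.1.1)
      (Function.update (Function.update X e.1.1 x) e.1.2 y p.1.2)) ↔
      (∀ p ∈ deleteStar S e.1.2, R p (Function.update X e.1.1 x p.1.1)
        (Function.update X e.1.1 x p.1.2)) ∧
      (∀ p ∈ deleteStar S e.1.1, R p (Function.update X e.1.2 y p.1.1)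
        (Function.update X e.1.2 y p.1.2)) ∧ R e x y := by
    intro y
    have hne : e.1.1 ≠ e.1.2 := e.2.ne
    conv_lhs => rw [← Finset.insert_erase he]
    rw [Finset.forall_mem_insert, update_update_satisfies_iff]
    simp only [Function.update_self, Function.update_of_ne hne]
    tauto
  simp only [hS, ite_and]
  split_ifs <;> simp

lemma abs_card_sub_erase_le {A : Finset V} (hA : A.Nonempty) {R : IndexPair t → V → V → Prop}
    {S : Finset (IndexPair t)} {e : IndexPair t} (he : e ∈ S) {δ Λ : ℝ} (hΛ : 0 ≤ Λ)
    (hR : ∀ U W : Finset V, |(∑ x ∈ U, ∑ y ∈ W, if R e x y then (1 : ℝ) else 0) - δ * (#U * #W)|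
      ≤ Λ * (√(#U : ℝ) * √(#W : ℝ))) :
    |(#(constrainedTuples A R S) : ℝ) - δ * #(constrainedTuples A R (S.erase e))| * #A ≤
      Λ * (√(#(constrainedTuples A R (deleteStar S e.1.2)) : ℝ) *
        √(#(constrainedTuples A R (deleteStar S e.1.1)) : ℝ)) := by
  have hA' : (0 : ℝ) < #A := by exact_mod_cast hA.card_pos
  set N := (#(constrainedTuples A R S) : ℝ)
  set N' := (#(constrainedTuples A R (S.erase e)) : ℝ)
  set B := Fintype.piFinset (fun _ : Fin t => A)
  set u := fun X => admissible A R (deleteStar S e.1.2) X e.1.1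
  set w := fun X => admissible A R (deleteStar S e.1.1) X e.1.2
  have h1 : (#A : ℝ) * (#A * (N - δ * N')) = ∑ X ∈ B,
      ((∑ x ∈ u X, ∑ y ∈ w X, if R e x y then (1 : ℝ) else 0) - δ * (#(u X) * #(w X))) := by
    rw [Finset.sum_sub_distrib, ← Finset.mul_sum, ← card_constrainedTuples_erase,
      ← card_constrainedTuples_eq A R S he]
    ring
  have h2 : |(#A : ℝ) * (#A * (N - δ * N'))| ≤ Λ * ∑ X ∈ B, √(#(u X) : ℝ) * √(#(w X) : ℝ) := by
    rw [h1, Finset.mul_sum]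
    exact (Finset.abs_sum_le_sum_abs _ _).trans (Finset.sum_le_sum fun X _ => hR _ _)
  have h3 : ∑ X ∈ B, √(#(u X) : ℝ) * √(#(w X) : ℝ) ≤
      √(∑ X ∈ B, (#(u X) : ℝ)) * √(∑ X ∈ B, (#(w X) : ℝ)) :=
    Real.sum_sqrt_mul_sqrt_le _ (fun _ => by positivity) (fun _ => by positivity)
  -- Each of the two square roots contributes √`#A`; together they cancel one of the two factors
  -- `#A` in `h1`.
  rw [sum_card_admissible, sum_card_admissible, Real.sqrt_mul hA'.le, Real.sqrt_mul hA'.le,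
    mul_mul_mul_comm, Real.mul_self_sqrt hA'.le] at h3
  rw [abs_mul, abs_mul, abs_of_pos hA'] at h2
  have h4 := h2.trans (mul_le_mul_of_nonneg_left h3 hΛ)
  refine le_of_mul_le_mul_left ?_ hA'
  linarith

lemma le_mul_of_abs_sub_le {x M ε : ℝ} (h : |x - M| ≤ (ε - 1) * M) : x ≤ ε * M := by
  have := (abs_le.1 h).2
  linarith

/-- If all constraints are pseudo-random of density about `1 / q`, then `S` is satisfied by
about `|A| ^ t / q ^ |S|` points of `A ^ t`. -/
theorem abs_card_constrainedTuples_sub_le {A : Finset V} (hA : A.Nonempty)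
    {R : IndexPair t → V → V → Prop} {q δ Λ η : ℝ} (hq : 1 ≤ q) (hΛ : 0 ≤ Λ) (hδ : 0 ≤ δ)
    (hδq : |δ * q - 1| ≤ η / 2) (hΛA : Λ * q ^ t ≤ η / 2 * (#A * q))
    (S : Finset (IndexPair t))
    (hR : ∀ e ∈ S, ∀ U W : Finset V,
      |(∑ x ∈ U, ∑ y ∈ W, if R e x y then (1 : ℝ) else 0) - δ * (#U * #W)| ≤
        Λ * (√(#U : ℝ) * √(#W : ℝ))) :
    |(#(constrainedTuples A R S) : ℝ) - #A ^ t / q ^ #S| ≤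
      ((1 + η) ^ #S - 1) * (#A ^ t / q ^ #S) := by
  have hA' : (0 : ℝ) < #A := by exact_mod_cast hA.card_pos
  have hq0 : 0 < q := by linarith
  have hη : 0 ≤ η := by linarith [abs_nonneg (δ * q - 1)]
  induction hs : #S using Nat.strong_induction_on generalizing S with
  | _ s ih =>
  subst hs
  rcases S.eq_empty_or_nonempty with rfl | ⟨e, he⟩
  · simp [constrainedTuples]
  have hcard : #(S.erase e) + 1 = #S := Finset.card_erase_add_one he
  set s := #(S.erase e)
  have ih1 := ih s (by omega) (S.erase e) (fun p hp => hR p (mem_of_mem_erase hp)) rfl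
  -- At most t - 1 constraints are lost, so the count is at most about q^(t-1) times the expected
  -- count for S; the factor q is kept on the left to avoid the exponent t - 1.
  have hstar : ∀ i, e.1.1 = i ∨ e.1.2 = i → (#(constrainedTuples A R (deleteStar S i)) : ℝ) * q ≤
      (1 + η) ^ s * (#A ^ t / q ^ #S) * q ^ t := by
    intro i hi
    have hsub := deleteStar_subset_erase (S := S) hi
    have hle : #(deleteStar S i) ≤ s := card_le_card hsub
    have h1 := le_mul_of_abs_sub_le <| ih #(deleteStar S i) (by omega) (deleteStar S i)
      (fun p hp => hR p (mem_of_mem_erase (hsub hp))) rfl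
    have h2 := card_deleteStar S i
    have h3 := occurrences_lt S i
    calc (#(constrainedTuples A R (deleteStar S i)) : ℝ) * q
        ≤ (1 + η) ^ #(deleteStar S i) * (#A ^ t / q ^ #(deleteStar S i)) * q := by gcongr
      _ ≤ (1 + η) ^ s * (#A ^ t / q ^ #(deleteStar S i)) * q := by
          gcongr
          linarith
      _ = (1 + η) ^ s * #A ^ t * (q / q ^ #(deleteStar S i)) := by ring
      _ ≤ (1 + η) ^ s * #A ^ t * (q ^ t / q ^ #S) := by
          gcongr ?_ * ?_
          rw [div_le_div_iff₀ (by positivity) (by positivity), ← pow_succ', ← pow_add]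
          exact pow_le_pow_right₀ hq (by omega)
      _ = _ := by ring
  have herr := abs_card_sub_erase_le hA he hΛ (hR e he)
  set N := (#(constrainedTuples A R S) : ℝ)
  set N' := (#(constrainedTuples A R (S.erase e)) : ℝ)
  set M := (#A : ℝ) ^ t / q ^ #S
  have hM : 0 ≤ M := by positivity
  have hM' : (#A : ℝ) ^ t / q ^ s = q * M := by
    simp only [M]
    rw [← hcard, pow_succ]
    field_simp
  rw [hM'] at ih1
  set G := (1 + η) ^ s
  have hG : 1 ≤ G := one_le_pow₀ (by linarith)
  have hsqrt : √(#(constrainedTuples A R (deleteStar S e.1.2)) : ℝ) *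
      √(#(constrainedTuples A R (deleteStar S e.1.1)) : ℝ) ≤ G * M * q ^ t / q := by
    have h1 := (le_div_iff₀ hq0).2 (hstar e.1.1 (Or.inl rfl))
    have h2 := (le_div_iff₀ hq0).2 (hstar e.1.2 (Or.inr rfl))
    calc _ ≤ √(G * M * q ^ t / q) * √(G * M * q ^ t / q) := by gcongr
      _ = _ := Real.mul_self_sqrt (by positivity)
  have herr2 : |N - δ * N'| ≤ η / 2 * (G * M) := by
    refine le_of_mul_le_mul_right ?_ hA'
    refine herr.trans ((mul_le_mul_of_nonneg_left hsqrt hΛ).trans ?_)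
    calc Λ * (G * M * q ^ t / q) = G * M / q * (Λ * q ^ t) := by ring
      _ ≤ G * M / q * (η / 2 * (#A * q)) := by gcongr
      _ = _ := by field_simp
  -- The error inherited from S \ {e}, scaled by δq ≤ 1 + η/2, plus the error of δ against 1/q.
  -- Together with `herr2` this adds up exactly to G(1 + η) - 1 times M.
  have hmain : |δ * N' - M| ≤ (G - 1) * M * (1 + η / 2) + η / 2 * M := by
    have h1 : δ * N' - M = δ * (N' - q * M) + (δ * q - 1) * M := by ring
    have hδq' : δ * q ≤ 1 + η / 2 := by linarith [(abs_le.1 hδq).2]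
    rw [h1]
    refine (abs_add_le _ _).trans (add_le_add ?_ ?_)
    · rw [abs_mul, abs_of_nonneg hδ]
      calc δ * |N' - q * M| ≤ δ * ((G - 1) * (q * M)) := by gcongr
        _ = (G - 1) * M * (δ * q) := by ring
        _ ≤ _ := by
          have : 0 ≤ (G - 1) * M := mul_nonneg (by linarith) hM
          gcongr
    · rw [abs_mul, abs_of_nonneg hM]
      gcongr
  have hfin : |N - M| ≤ |N - δ * N'| + |δ * N' - M| := abs_sub_le _ _ _
  rw [← hcard, pow_succ]
  change |N - M| ≤ (G * (1 + η) - 1) * M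
  linarith

end Counting

/-! ### Operator norm bounds, characters composed with the norm, and orthogonality. -/

section Kernels

open Finset
open scoped ComplexConjugate

/-- The matrix `κ` has operator norm at most `Λ` on `ℓ²`. -/
def KernelBound {V W : Type*} [Fintype V] [Fintype W] (κ : V → W → ℂ) (Λ : ℝ) : Prop :=
  ∀ a : V → ℂ, ∑ y, ‖∑ x, a x * κ x y‖ ^ 2 ≤ Λ ^ 2 * ∑ x, ‖a x‖ ^ 2

lemma KernelBound.norm_sum_le {V W : Type*} [Fintype V] [Fintype W] {κ : V → W → ℂ} {Λ : ℝ}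
    (h : KernelBound κ Λ) (hΛ : 0 ≤ Λ) (A : Finset V) (B : Finset W) :
    ‖∑ x ∈ A, ∑ y ∈ B, κ x y‖ ≤ Λ * (√(#A : ℝ) * √(#B : ℝ)) := by
  classical
  have h1 := h fun x => if x ∈ A then 1 else 0
  have h2 : ∑ x, ‖(if x ∈ A then 1 else 0 : ℂ)‖ ^ 2 = #A := by
    simp [apply_ite]
  rw [h2] at h1
  simp only [ite_mul, one_mul, zero_mul, Finset.sum_ite_mem, Finset.univ_inter] at h1
  have h3 : ‖∑ x ∈ A, ∑ y ∈ B, κ x y‖ ^ 2 ≤ #B * ∑ y ∈ B, ‖∑ x ∈ A, κ x y‖ ^ 2 := by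
    rw [Finset.sum_comm]
    calc ‖∑ y ∈ B, ∑ x ∈ A, κ x y‖ ^ 2 ≤ (∑ y ∈ B, ‖∑ x ∈ A, κ x y‖) ^ 2 := by
          gcongr; exact _root_.norm_sum_le _ _
      _ ≤ _ := sq_sum_le_card_mul_sum_sq
  have h4 : ∑ y ∈ B, ‖∑ x ∈ A, κ x y‖ ^ 2 ≤ ∑ y, ‖∑ x ∈ A, κ x y‖ ^ 2 :=
    Finset.sum_le_sum_of_subset_of_nonneg (subset_univ _) fun _ _ _ => by positivity
  refine le_of_sq_le_sq ?_ (by positivity)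
  rw [mul_pow, mul_pow, Real.sq_sqrt (by positivity), Real.sq_sqrt (by positivity)]
  calc _ ≤ _ := h3
    _ ≤ #B * (Λ ^ 2 * #A) := by gcongr; exact h4.trans h1
    _ = _ := by ring

/-- Apply the bound for κ in the first variable with y' fixed, then the bound for κ' with x fixed.
-/
lemma KernelBound.tensor {V W V' W' : Type*} [Fintype V] [Fintype W] [Fintype V'] [Fintype W']
    {κ : V → W → ℂ} {κ' : V' → W' → ℂ} {Λ Λ' : ℝ} (h : KernelBound κ Λ)
    (h' : KernelBound κ' Λ') :
    KernelBound (fun (x : V × V') (y : W × W') => κ x.1 y.1 * κ' x.2 y.2) (Λ * Λ') := by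
  intro a
  simp only [Fintype.sum_prod_type]
  have h1 : ∀ y', ∑ y, ‖∑ x, ∑ x', a (x, x') * (κ x y * κ' x' y')‖ ^ 2 ≤
      Λ ^ 2 * ∑ x, ‖∑ x', a (x, x') * κ' x' y'‖ ^ 2 := by
    intro y'
    convert h fun x => ∑ x', a (x, x') * κ' x' y' using 5
    rw [Finset.sum_mul]
    refine Finset.sum_congr rfl fun _ _ => by ring
  rw [Finset.sum_comm]
  calc _ ≤ ∑ y', Λ ^ 2 * ∑ x, ‖∑ x', a (x, x') * κ' x' y'‖ ^ 2 := Finset.sum_le_sum fun y' _ => h1 y'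
    _ = Λ ^ 2 * ∑ x, ∑ y', ‖∑ x', a (x, x') * κ' x' y'‖ ^ 2 := by
        rw [← Finset.mul_sum, Finset.sum_comm]
    _ ≤ Λ ^ 2 * ∑ x, Λ' ^ 2 * ∑ x', ‖a (x, x')‖ ^ 2 := by
        gcongr with x
        exact h' fun x' => a (x, x')
    _ = _ := by rw [← Finset.mul_sum]; ring

lemma kernelBound_one (V : Type*) [Fintype V] :
    KernelBound (fun _ _ : V => 1) (Fintype.card V) := by
  intro a
  simp only [mul_one, sum_const, card_univ, nsmul_eq_mul]
  have h : ‖∑ x, a x‖ ^ 2 ≤ Fintype.card V * ∑ x, ‖a x‖ ^ 2 :=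
    calc ‖∑ x, a x‖ ^ 2 ≤ (∑ x, ‖a x‖) ^ 2 := by gcongr; exact norm_sum_le _ _
      _ ≤ _ := sq_sum_le_card_mul_sum_sq
  calc _ ≤ (Fintype.card V : ℝ) * (Fintype.card V * ∑ x, ‖a x‖ ^ 2) := by gcongr
    _ = _ := by ring

lemma kernelBound_add_eq_zero (K : Type*) [AddCommGroup K] [Fintype K] [DecidableEq K] :
    KernelBound (fun x y : K => if x + y = 0 then 1 else 0) 1 := by
  intro a
  simp only [add_eq_zero_iff_eq_neg, mul_ite, mul_one, mul_zero, sum_ite_eq', mem_univ, if_true,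
    one_pow, one_mul]
  exact (Equiv.sum_comp (Equiv.neg K) fun x => ‖a x‖ ^ 2).le

section MulChar

variable {K : Type*} [Field K] [Fintype K]

/-- With z = b + y the summand is ψ(1 + (a - b)/z) for z ≠ 0 and 0 for z = 0. Since 0⁻¹ = 0,
completing the sum to all z adds ψ(1) = 1, whence the -1; for a ≠ b the completed sum runs over all
values of ψ and vanishes. -/
lemma sum_mulChar_add_mul_conj [DecidableEq K] {ψ : MulChar K ℂ} (hψ : ψ ≠ 1) (a b : K) :
    ∑ y, ψ (a + y) * conj (ψ (b + y)) = (if a = b then (Fintype.card K : ℂ) else 0) - 1 := by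
  have h1 : ∑ y, ψ (a + y) * conj (ψ (b + y)) =
      ∑ z, ψ (1 + (a - b) * z⁻¹) * (if z = 0 then 0 else 1) := by
    refine Fintype.sum_equiv (Equiv.addLeft b) _ _ fun y => ?_
    rw [Equiv.coe_addLeft]
    by_cases h : b + y = 0
    · simp [h, MulChar.map_zero]
    · rw [show conj (ψ (b + y)) = ψ⁻¹ (b + y) from MulChar.star_apply' ψ _, MulChar.inv_apply',
        ← map_mul, if_neg h, mul_one]
      congr 1
      field_simp
      ring
  rw [h1]
  have h2 : ∑ z, ψ (1 + (a - b) * z⁻¹) * (if z = 0 then 0 else 1 : ℂ) =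
      ∑ z, ψ (1 + (a - b) * z) - 1 := by
    rw [← Equiv.sum_comp (Equiv.inv K) fun z => ψ (1 + (a - b) * z)]
    have : ∀ z, ψ (1 + (a - b) * z⁻¹) * (if z = 0 then 0 else 1 : ℂ) =
        ψ (1 + (a - b) * z⁻¹) - if z = 0 then 1 else 0 := by
      intro z
      split_ifs with h <;> simp [h]
    simp [this]
  rw [h2]
  split_ifs with h
  · simp [h]
  · have h3 : a - b ≠ 0 := sub_ne_zero.2 h
    rw [← MulChar.sum_eq_zero_of_ne_one hψ]
    congr 1
    exact Equiv.sum_comp ((Equiv.mulLeft₀ (a - b) h3).trans (Equiv.addLeft 1)) ψ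

/-- The Gram matrix is |K| I - J with J the all-ones matrix, and J is positive semidefinite, so it
can be dropped. -/
lemma kernelBound_mulChar {ψ : MulChar K ℂ} (hψ : ψ ≠ 1) :
    KernelBound (fun x y : K => ψ (x + y)) (√(Fintype.card K : ℝ)) := by
  classical
  intro a
  rw [Real.sq_sqrt (by positivity)]
  have h : ((∑ y, ‖∑ x, a x * ψ (x + y)‖ ^ 2 : ℝ) : ℂ) =
      ((Fintype.card K * ∑ x, ‖a x‖ ^ 2 - ‖∑ x, a x‖ ^ 2 : ℝ) : ℂ) := by
    push_cast
    simp only [← Complex.mul_conj']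
    simp only [map_sum, map_mul, Finset.sum_mul_sum]
    rw [Finset.sum_comm]
    have h1 : ∀ x, ∑ y, ∑ x', a x * ψ (x + y) * (conj (a x') * conj (ψ (x' + y))) =
        ∑ x', a x * conj (a x') * ((if x = x' then (Fintype.card K : ℂ) else 0) - 1) := by
      intro x
      rw [Finset.sum_comm]
      refine Finset.sum_congr rfl fun x' _ => ?_
      rw [← sum_mulChar_add_mul_conj hψ, Finset.mul_sum]
      refine Finset.sum_congr rfl fun _ _ => by ring
    simp only [h1, mul_sub, mul_one, Finset.sum_sub_distrib, mul_ite, mul_zero, sum_ite_eq,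
      mem_univ, if_true]
    rw [← Finset.sum_mul, mul_comm]
  have h' := Complex.ofReal_injective h
  rw [h']
  linarith [sq_nonneg ‖∑ x, a x‖]

end MulChar

section Norm

variable {F K : Type*} [Field F] [Field K] [Algebra F K] [Finite K]

/-- The multiplicative character `χ ∘ N` of `K`, for a multiplicative character `χ` of `F`. -/
noncomputable def normChar (K : Type*) [Field K] [Algebra F K] [Finite K] (χ : MulChar F ℂ) :
    MulChar K ℂ where
  toMonoidHom := χ.toMonoidHom.comp (Algebra.norm F)
  map_nonunit' a ha := by
    have : Module.Finite F K := Module.Finite.of_finite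
    have ha0 : a = 0 := by simpa using ha
    simp [ha0, MulChar.map_zero]

lemma normChar_apply (χ : MulChar F ℂ) (x : K) : normChar K χ x = χ (Algebra.norm F x) := rfl

lemma normChar_ne_one [Finite F] {χ : MulChar F ℂ} (hχ : χ ≠ 1) : normChar K χ ≠ 1 := by
  obtain ⟨a, ha⟩ := MulChar.ne_one_iff.1 hχ
  obtain ⟨x, hx⟩ := FiniteField.unitsMap_norm_surjective F K a
  refine MulChar.ne_one_iff.2 ⟨x, ?_⟩
  rw [normChar_apply]
  rwa [← hx] at ha

end Norm

section Orthogonality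

variable {F : Type*} [Field F] [Fintype F]

lemma sum_mulChar_eq [Fintype (MulChar F ℂ)] [DecidableEq F] (a : F) :
    ∑ χ : MulChar F ℂ, χ a = if a = 1 then (Fintype.card F - 1 : ℂ) else 0 := by
  split_ifs with ha
  · subst ha
    have h1 := MulChar.card_eq_card_units_of_hasEnoughRootsOfUnity F ℂ
    rw [Nat.card_eq_fintype_card, Nat.card_units, Nat.card_eq_fintype_card] at h1
    simp [h1, Nat.cast_sub Fintype.card_pos]
  · obtain ⟨χ, hχ⟩ := MulChar.exists_apply_ne_one_of_hasEnoughRootsOfUnity F ℂ ha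
    refine eq_zero_of_mul_eq_self_left hχ ?_
    simp only [Finset.mul_sum, ← MulChar.mul_apply]
    exact Fintype.sum_bijective _ (Group.mulLeft_bijective χ) _ _ fun χ' ↦ rfl

lemma sum_mulChar_mul_conj [Fintype (MulChar F ℂ)] [DecidableEq F] (a b : F) :
    ∑ χ : MulChar F ℂ, χ a * conj (χ b) =
      if a = b ∧ b ≠ 0 then (Fintype.card F - 1 : ℂ) else 0 := by
  by_cases hb : b = 0
  · simp [hb, MulChar.map_zero]
  · have : ∀ χ : MulChar F ℂ, χ a * conj (χ b) = χ (a * b⁻¹) := fun χ => by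
      rw [show conj (χ b) = χ⁻¹ b from MulChar.star_apply' χ _, MulChar.inv_apply', ← map_mul]
    simp only [this, sum_mulChar_eq, mul_inv_eq_one₀ hb, hb, ne_eq, not_false_eq_true, and_true]

end Orthogonality

end Kernels

/-! ### Pseudo-randomness of the norm relations. -/

section PseudoRandom

open Finset
open scoped Classical ComplexConjugate

variable {F K : Type*} [Field F] [Field K] [Algebra F K] [Fintype F] [Fintype K]

lemma sum_sum_sum_comm_left {ι V W : Type*} (s : Finset ι) (U : Finset V) (B : Finset W)
    (f : ι → V → W → ℂ) :
    ∑ x ∈ U, ∑ y ∈ B, ∑ i ∈ s, f i x y = ∑ i ∈ s, ∑ x ∈ U, ∑ y ∈ B, f i x y := by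
  rw [Finset.sum_comm (s := s)]
  exact Finset.sum_congr rfl fun x _ => Finset.sum_comm

lemma sum_nontrivial_mulChar_mul_conj [Fintype (MulChar F ℂ)] (a b : F) :
    ∑ χ ∈ univ.erase (1 : MulChar F ℂ), χ a * conj (χ b) =
      (if a = b ∧ b ≠ 0 then (Fintype.card F - 1 : ℂ) else 0) -
        (if a = 0 then 0 else 1) * (if b = 0 then 0 else 1) := by
  have h0 : ∀ c : F, (1 : MulChar F ℂ) c = if c = 0 then 0 else 1 := fun c => by
    split_ifs with h
    · simp [h, MulChar.map_zero]
    · exact MulChar.one_apply (isUnit_iff_ne_zero.2 h)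
  rw [← sum_mulChar_mul_conj a b, ← Finset.add_sum_erase univ _ (mem_univ (1 : MulChar F ℂ)),
    h0 a, h0 b]
  split_ifs <;> simp

lemma card_nontrivial_mulChar [Fintype (MulChar F ℂ)] :
    (#(univ.erase (1 : MulChar F ℂ)) : ℝ) = Fintype.card F - 2 := by
  have h1 := MulChar.card_eq_card_units_of_hasEnoughRootsOfUnity F ℂ
  rw [Nat.card_eq_fintype_card, Nat.card_units, Nat.card_eq_fintype_card] at h1
  have h2 : 1 < Fintype.card F := Fintype.one_lt_card
  rw [card_erase_of_mem (mem_univ _), card_univ, h1, Nat.sub_sub, Nat.cast_sub (by omega)]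
  norm_num

lemma norm_sum_sum_sum_le {ι V : Type*} (s : Finset ι) (U B : Finset V) (f : ι → V → V → ℂ)
    {c : ℝ} (h : ∀ i ∈ s, ‖∑ x ∈ U, ∑ y ∈ B, f i x y‖ ≤ c) :
    ‖∑ x ∈ U, ∑ y ∈ B, ∑ i ∈ s, f i x y‖ ≤ #s * c := by
  rw [sum_sum_sum_comm_left, ← nsmul_eq_mul]
  exact (norm_sum_le _ _).trans (Finset.sum_le_card_nsmul _ _ _ h)

lemma ofReal_sum_boole_sub {V : Type*} (U B : Finset V) (R : V → V → Prop) (c : ℝ) :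
    (((∑ x ∈ U, ∑ y ∈ B, if R x y then (1 : ℝ) else 0) - c * (#U * #B) : ℝ) : ℂ) =
      ∑ x ∈ U, ∑ y ∈ B, ((if R x y then (1 : ℂ) else 0) - c) := by
  have h : ∀ x y, ((if R x y then (1 : ℝ) else 0 : ℝ) : ℂ) = if R x y then 1 else 0 :=
    fun x y => by split_ifs <;> simp
  simp only [Finset.sum_sub_distrib, Complex.ofReal_sub, Complex.ofReal_sum, h, sum_const,
    nsmul_eq_mul]
  push_cast
  ring

lemma norm_mulChar_apply {a : F} (ha : a ≠ 0) (χ : MulChar F ℂ) : ‖χ a‖ = 1 := by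
  have h : χ a * conj (χ a) = 1 := by
    rw [show conj (χ a) = χ⁻¹ a from MulChar.star_apply' χ _, MulChar.inv_apply', ← map_mul,
      mul_inv_cancel₀ ha, map_one]
  rw [Complex.mul_conj'] at h
  have h' : ‖χ a‖ ^ 2 = 1 := by exact_mod_cast h
  exact (pow_eq_one_iff_of_nonneg (norm_nonneg _) two_ne_zero).1 h'

/-- The relation `N(x + y) = c` is pseudo-random if `c ≠ 0`. -/
lemma abs_sum_norm_add_eq_sub_le {c : F} (hc : c ≠ 0) (U B : Finset K) :
    |(∑ x ∈ U, ∑ y ∈ B, if Algebra.norm F (x + y) = c then (1 : ℝ) else 0) -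
        1 / ((Fintype.card F : ℝ) - 1) * (#U * #B)| ≤
      √(Fintype.card K : ℝ) * (√(#U : ℝ) * √(#B : ℝ)) := by
  have : Fintype (MulChar F ℂ) := Fintype.ofFinite _
  have : Module.Finite F K := Module.Finite.of_finite
  have hq : (2 : ℝ) ≤ Fintype.card F := by exact_mod_cast Fintype.one_lt_card (α := F)
  have hQ : (1 : ℝ) ≤ √(Fintype.card K : ℝ) := by
    rw [Real.one_le_sqrt]; exact_mod_cast Fintype.card_pos (α := K)
  set q := Fintype.card F
  set r := √(#U : ℝ) * √(#B : ℝ)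
  have hr : 0 ≤ r := by positivity
  have hqC : ((q : ℂ) - 1) ≠ 0 := by
    have : ((q : ℝ) - 1) ≠ 0 := by linarith
    exact_mod_cast this
  -- The trivial character supplies the main term 1 except where x + y = 0; the subtracted indicator
  -- repairs this.
  have hpt : ∀ x y : K, (if Algebra.norm F (x + y) = c then (1 : ℂ) else 0) - 1 / (q - 1) =
      1 / (q - 1) * (∑ χ ∈ univ.erase (1 : MulChar F ℂ), normChar K χ (x + y) * conj (χ c) -
        if x + y = 0 then 1 else 0) := by
    intro x y
    simp only [normChar_apply, sum_nontrivial_mulChar_mul_conj, Algebra.norm_eq_zero_iff, hc]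
    by_cases h0 : x + y = 0
    · have : ¬ (0 : F) = c := fun h => hc h.symm
      simp [h0, this]
    · by_cases h1 : Algebra.norm F (x + y) = c
      · simp [h1, h0, hc]
        field_simp
        rfl
      · simp [h1, h0]
  have hchar : ∀ χ ∈ univ.erase (1 : MulChar F ℂ),
      ‖∑ x ∈ U, ∑ y ∈ B, normChar K χ (x + y) * conj (χ c)‖ ≤ √(Fintype.card K : ℝ) * r := by
    intro χ hχ
    simp only [← Finset.sum_mul]
    rw [norm_mul]
    have h1 := (kernelBound_mulChar (normChar_ne_one (K := K) (ne_of_mem_erase hχ))).norm_sum_le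
      (by positivity) U B
    have h2 : ‖conj (χ c)‖ ≤ 1 := by
      rw [RCLike.norm_conj]
      exact (norm_mulChar_apply hc χ).le
    exact (mul_le_of_le_one_right (norm_nonneg _) h2).trans h1
  have h1 := norm_sum_sum_sum_le _ U B (fun χ x y => normChar K χ (x + y) * conj (χ c)) hchar
  have h2 := (kernelBound_add_eq_zero K).norm_sum_le zero_le_one U B
  have hid : ((((∑ x ∈ U, ∑ y ∈ B, if Algebra.norm F (x + y) = c then (1 : ℝ) else 0) -
        1 / ((q : ℝ) - 1) * (#U * #B)) : ℝ) : ℂ) = 1 / (q - 1) *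
      (∑ x ∈ U, ∑ y ∈ B, ∑ χ ∈ univ.erase (1 : MulChar F ℂ), normChar K χ (x + y) * conj (χ c) -
        ∑ x ∈ U, ∑ y ∈ B, if x + y = 0 then 1 else 0) := by
    rw [ofReal_sum_boole_sub]
    simp only [← Finset.sum_sub_distrib]
    rw [Finset.mul_sum]
    refine Finset.sum_congr rfl fun x _ => ?_
    rw [Finset.mul_sum]
    refine Finset.sum_congr rfl fun y _ => ?_
    rw [← hpt]
    push_cast
    rfl
  rw [← Real.norm_eq_abs, ← Complex.norm_real, hid, norm_mul]
  have hn : ‖(1 / (q - 1) : ℂ)‖ = 1 / ((q : ℝ) - 1) := by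
    rw [show (1 / (q - 1) : ℂ) = ((1 / ((q : ℝ) - 1) : ℝ) : ℂ) by push_cast; rfl,
      Complex.norm_real, Real.norm_of_nonneg]
    exact one_div_nonneg.2 (by linarith)
  -- The q - 2 nontrivial characters and the antidiagonal give (q - 2)√|K| + 1 ≤ (q - 1)√|K|.
  rw [hn, one_div_mul_eq_div, div_le_iff₀ (by linarith)]
  refine (norm_sub_le _ _).trans ((add_le_add h1 h2).trans ?_)
  rw [card_nontrivial_mulChar]
  nlinarith [mul_le_mul_of_nonneg_right hQ hr]

/-- The relation `N(x + y) = N(x' + y')` between pairs `(x, x')` and `(y, y')` is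
pseudo-random. -/
lemma abs_sum_norm_add_eq_norm_add_sub_le (U B : Finset (K × K)) :
    |(∑ x ∈ U, ∑ y ∈ B,
        if Algebra.norm F (x.1 + y.1) = Algebra.norm F (x.2 + y.2) then (1 : ℝ) else 0) -
        1 / ((Fintype.card F : ℝ) - 1) * (#U * #B)| ≤
      4 * Fintype.card K * (√(#U : ℝ) * √(#B : ℝ)) := by
  have : Fintype (MulChar F ℂ) := Fintype.ofFinite _
  have : Module.Finite F K := Module.Finite.of_finite
  have hq : (2 : ℝ) ≤ Fintype.card F := by exact_mod_cast Fintype.one_lt_card (α := F)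
  have hQ : (1 : ℝ) ≤ Fintype.card K := by exact_mod_cast Fintype.card_pos (α := K)
  set q := Fintype.card F
  set Q := (Fintype.card K : ℝ)
  set r := √(#U : ℝ) * √(#B : ℝ)
  have hr : 0 ≤ r := by positivity
  have hqC : ((q : ℂ) - 1) ≠ 0 := by
    have : ((q : ℝ) - 1) ≠ 0 := by linarith
    exact_mod_cast this
  set P : K → K → ℂ := fun x y => if x + y = 0 then 1 else 0
  -- If both sums vanish, all characters are 0 but the relation holds; the coefficient q makes the
  -- correction -1 - 1 + q = q - 2 there.
  have hpt : ∀ x y : K × K,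
      (if Algebra.norm F (x.1 + y.1) = Algebra.norm F (x.2 + y.2) then (1 : ℂ) else 0) -
        1 / (q - 1) =
      1 / (q - 1) * (∑ χ ∈ univ.erase (1 : MulChar F ℂ),
        normChar K χ (x.1 + y.1) * normChar K χ⁻¹ (x.2 + y.2) -
        P x.1 y.1 * 1 - 1 * P x.2 y.2 + q * (P x.1 y.1 * P x.2 y.2)) := by
    intro x y
    have hconj : ∀ (χ : MulChar F ℂ) (a : F), χ⁻¹ a = conj (χ a) := fun χ a =>
      (MulChar.star_apply' χ a).symm
    simp only [normChar_apply, hconj, sum_nontrivial_mulChar_mul_conj, Algebra.norm_eq_zero_iff, P]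
    by_cases h0 : x.1 + y.1 = 0 <;> by_cases h1 : x.2 + y.2 = 0
    · simp [h0, h1]
      field_simp
      ring
    · have : ¬ (0 : F) = Algebra.norm F (x.2 + y.2) := fun h =>
        h1 (Algebra.norm_eq_zero_iff.1 h.symm)
      simp [h0, h1, this]
    · simp [h0, h1]
    · by_cases h : Algebra.norm F (x.1 + y.1) = Algebra.norm F (x.2 + y.2)
      · simp [h0, h1, h]
        field_simp
        rfl
      · simp [h0, h1, h]
  have hchar : ∀ χ ∈ univ.erase (1 : MulChar F ℂ),
      ‖∑ x ∈ U, ∑ y ∈ B, normChar K χ (x.1 + y.1) * normChar K χ⁻¹ (x.2 + y.2)‖ ≤ Q * r := by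
    intro χ hχ
    have hχ1 := ne_of_mem_erase hχ
    have h1 := ((kernelBound_mulChar (normChar_ne_one (K := K) hχ1)).tensor
      (kernelBound_mulChar (normChar_ne_one (K := K) (inv_ne_one.2 hχ1)))).norm_sum_le
      (by positivity) U B
    rwa [Real.mul_self_sqrt (by positivity)] at h1
  have h1 := norm_sum_sum_sum_le _ U B
    (fun χ x y => normChar K χ (x.1 + y.1) * normChar K χ⁻¹ (x.2 + y.2)) hchar
  have hP := kernelBound_add_eq_zero K
  -- A correction supported on one vanishing sum leaves the all-ones matrix in the other coordinate,
  -- so its norm is |K|.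
  have h2 := (hP.tensor (kernelBound_one K)).norm_sum_le (by positivity) U B
  have h3 := ((kernelBound_one K).tensor hP).norm_sum_le (by positivity) U B
  have h4 := (hP.tensor hP).norm_sum_le (by positivity) U B
  have hid : ((((∑ x ∈ U, ∑ y ∈ B,
        if Algebra.norm F (x.1 + y.1) = Algebra.norm F (x.2 + y.2) then (1 : ℝ) else 0) -
        1 / ((q : ℝ) - 1) * (#U * #B)) : ℝ) : ℂ) = 1 / (q - 1) *
      (∑ x ∈ U, ∑ y ∈ B, ∑ χ ∈ univ.erase (1 : MulChar F ℂ),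
        normChar K χ (x.1 + y.1) * normChar K χ⁻¹ (x.2 + y.2) -
        ∑ x ∈ U, ∑ y ∈ B, P x.1 y.1 * 1 - ∑ x ∈ U, ∑ y ∈ B, 1 * P x.2 y.2 +
        q * ∑ x ∈ U, ∑ y ∈ B, P x.1 y.1 * P x.2 y.2) := by
    rw [ofReal_sum_boole_sub]
    simp only [Finset.mul_sum (a := (q : ℂ)) (s := U), Finset.mul_sum (a := (q : ℂ)) (s := B),
      ← Finset.sum_sub_distrib, ← Finset.sum_add_distrib]
    rw [Finset.mul_sum]
    refine Finset.sum_congr rfl fun x _ => ?_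
    rw [Finset.mul_sum]
    refine Finset.sum_congr rfl fun y _ => ?_
    rw [← hpt]
    push_cast
    rfl
  rw [← Real.norm_eq_abs, ← Complex.norm_real, hid, norm_mul]
  have hn : ‖(1 / (q - 1) : ℂ)‖ = 1 / ((q : ℝ) - 1) := by
    rw [show (1 / (q - 1) : ℂ) = ((1 / ((q : ℝ) - 1) : ℝ) : ℂ) by push_cast; rfl,
      Complex.norm_real, Real.norm_of_nonneg]
    exact one_div_nonneg.2 (by linarith)
  rw [hn, one_div_mul_eq_div, div_le_iff₀ (by linarith)]
  have h5 : ‖(q : ℂ) * ∑ x ∈ U, ∑ y ∈ B, P x.1 y.1 * P x.2 y.2‖ ≤ q * (1 * 1 * r) := by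
    rw [norm_mul, Complex.norm_natCast]
    gcongr
  refine (norm_add_le _ _).trans ((add_le_add ((norm_sub_le _ _).trans
    (add_le_add ((norm_sub_le _ _).trans (add_le_add h1 h2)) h3)) h5).trans ?_)
  rw [card_nontrivial_mulChar]
  have hQr := mul_le_mul_of_nonneg_right hQ hr
  have h6 : (q : ℝ) * r ≤ q * (Q * r) := by gcongr; linarith
  have h7 : 0 ≤ (q - 2) * (Q * r) := mul_nonneg (by linarith) (by positivity)
  change (q - 2) * (Q * r) + 1 * Q * r + Q * 1 * r + q * (1 * 1 * r) ≤ 4 * Q * r * (q - 1)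
  nlinarith

end PseudoRandom

/-! ### From pseudo-random constraints to norm systems. -/

section NormSystems

open Finset
open scoped Classical

lemma card_indexPair (t : ℕ) : Fintype.card (IndexPair t) = t.choose 2 := by
  rw [Fintype.card_subtype, Finset.card_filter, ← Finset.univ_product_univ,
    Finset.sum_product_right]
  have h : ∀ j : Fin t, ∑ i : Fin t, (if (i, j).1 < (i, j).2 then 1 else 0) = (j : ℕ) := by
    intro j
    rw [← Finset.card_filter, ← Fin.card_Iio j]
    congr 1
    ext i
    simp
  rw [Finset.sum_congr rfl fun j _ => h j, Fin.sum_univ_eq_sum_range (fun i => i) t,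
    Finset.sum_range_id, Nat.choose_two_right]

lemma exists_one_add_pow_sub_one_le (m : ℕ) {ε : ℝ} (hε : 0 < ε) :
    ∃ η : ℝ, 0 < η ∧ ∀ s ≤ m, (1 + η) ^ s - 1 ≤ ε := by
  have hc : ContinuousAt (fun η : ℝ => (1 + η) ^ m) 0 := by fun_prop
  obtain ⟨d, hd, h⟩ := Metric.continuousAt_iff.1 hc ε hε
  refine ⟨d / 2, by positivity, fun s hs => ?_⟩
  have h1 := h (x := d / 2) (by rw [Real.dist_eq, sub_zero, abs_of_pos] <;> linarith)
  rw [Real.dist_eq, add_zero, one_pow] at h1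
  have h2 : (1 + d / 2) ^ s ≤ (1 + d / 2) ^ m := pow_le_pow_right₀ (by linarith) hs
  linarith [(abs_lt.1 h1).2]

lemma abs_one_div_sub_one_mul_sub_one_le {q η : ℝ} (hη : 0 < η) (hq : 2 / η + 2 ≤ q) :
    |1 / (q - 1) * q - 1| ≤ η / 2 := by
  have h0 : 0 < 2 / η := by positivity
  have h1 : 1 / (q - 1) * q - 1 = 1 / (q - 1) := by
    have : q - 1 ≠ 0 := by linarith
    field_simp
    ring
  rw [h1, abs_of_nonneg (one_div_nonneg.2 (by linarith))]
  rw [div_le_iff₀ (by linarith)]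
  have h2 : η / 2 * (2 / η + 1) ≤ η / 2 * (q - 1) := by gcongr; linarith
  have h3 : η / 2 * (2 / η + 1) = 1 + η / 2 := by field_simp
  linarith

variable {F K : Type*} [Field F] [Field K] [Algebra F K] {t : ℕ}

lemma numSolutions_eq (A : Finset K) (S : Finset (IndexPair t)) (lam : IndexPair t → F) :
    numSolutions F A S lam =
      #(constrainedTuples A (fun p x y => Algebra.norm F (x + y) = lam p) S) := by
  rw [numSolutions, ← Set.ncard_coe_finset]
  congr 1
  ext X
  simp [SolvesNormSystem, constrainedTuples]

/-- The values `N(X_i + X_j)`, `i < j`. -/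
noncomputable def pairNorms (F : Type*) {K : Type*} [Field F] [Field K] [Algebra F K] {t : ℕ}
    (X : Fin t → K) : IndexPair t → F :=
  fun p => Algebra.norm F (X p.1.1 + X p.1.2)

lemma numSolvable_eq (A : Finset K) :
    numSolvable F t A = #((Fintype.piFinset fun _ : Fin t => A).image (pairNorms F)) := by
  rw [numSolvable, ← Set.ncard_coe_finset]
  congr 1
  ext lam
  simp only [SolvesNormSystem, mem_univ, true_imp_iff, Set.mem_ofPred_eq, coe_image, Set.mem_image,
    mem_coe, Fintype.mem_piFinset, pairNorms, funext_iff]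

/-- Cauchy–Schwarz over the fibres of f: the colliding pairs number the sum of the squared fibre
sizes. -/
lemma sq_card_le_card_image_mul {α β : Type*} [DecidableEq β] (B : Finset α) (f : α → β) :
    (#B : ℝ) ^ 2 ≤ #(B.image f) * #((B ×ˢ B).filter fun z => f z.1 = f z.2) := by
  have h1 : (#B : ℝ) = ∑ b ∈ B.image f, (#(B.filter fun x => f x = b) : ℝ) := by
    exact_mod_cast Finset.card_eq_sum_card_image f B
  have h2 : (#((B ×ˢ B).filter fun z => f z.1 = f z.2) : ℝ) =
      ∑ b ∈ B.image f, (#(B.filter fun x => f x = b) : ℝ) ^ 2 := by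
    have h3 : ∀ z ∈ (B ×ˢ B).filter fun z => f z.1 = f z.2, f z.1 ∈ B.image f := by
      intro z hz
      simp only [mem_filter, mem_product] at hz
      exact mem_image_of_mem f hz.1.1
    rw [Finset.card_eq_sum_card_fiberwise h3]
    push_cast
    refine Finset.sum_congr rfl fun b _ => ?_
    rw [sq, ← Nat.cast_mul, ← Finset.card_product]
    congr 2
    ext z
    simp only [mem_filter, mem_product]
    constructor
    · rintro ⟨⟨⟨h1, h2⟩, h3⟩, h4⟩
      exact ⟨⟨h1, h4⟩, h2, h3 ▸ h4⟩
    · rintro ⟨⟨h1, h2⟩, h3, h4⟩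
      exact ⟨⟨⟨h1, h3⟩, h2.trans h4.symm⟩, h2⟩
  rw [h2, h1]
  exact sq_sum_le_card_mul_sum_sq

lemma card_pairNorms_eq (A : Finset K) :
    #(((Fintype.piFinset fun _ : Fin t => A) ×ˢ (Fintype.piFinset fun _ : Fin t => A)).filter
        fun z => pairNorms F z.1 = pairNorms F z.2) =
      #(constrainedTuples (A ×ˢ A) (fun (_ : IndexPair t) x y =>
        Algebra.norm F (x.1 + y.1) = Algebra.norm F (x.2 + y.2)) univ) := by
  refine Finset.card_nbij' (fun z i => (z.1 i, z.2 i))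
    (fun X => (fun i => (X i).1, fun i => (X i).2)) ?_ ?_ ?_ ?_
  · rintro ⟨X, Y⟩ h
    simp only [coe_filter, Set.mem_ofPred_eq, mem_product, Fintype.mem_piFinset, pairNorms,
      funext_iff, constrainedTuples, mem_univ, true_imp_iff] at h ⊢
    exact ⟨fun i => ⟨h.1.1 i, h.1.2 i⟩, h.2⟩
  · intro X h
    simp only [coe_filter, Set.mem_ofPred_eq, mem_product, Fintype.mem_piFinset, pairNorms,
      funext_iff, constrainedTuples, mem_univ, true_imp_iff] at h ⊢
    exact ⟨⟨fun i => (h.1 i).1, fun i => (h.1 i).2⟩, h.2⟩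
  · intro z _; rfl
  · intro X _; rfl

/-- The second moment is at most (1 + ε) times its expected value, so at least a fraction 1/(1 + ε)
≥ 1 - ε of all norm vectors is attained. -/
lemma numSolvable_ge [Fintype F] [Fintype K] {A : Finset K} (hA : A.Nonempty) {ε η : ℝ}
    (hε : 0 < ε) (hη : 0 < η) (hpow : (1 + η) ^ t.choose 2 - 1 ≤ ε)
    (hq : 2 / η + 2 ≤ (Fintype.card F : ℝ))
    (hcard : 4 * Fintype.card K * (Fintype.card F : ℝ) ^ t ≤
      η / 2 * ((#A : ℝ) ^ 2 * Fintype.card F)) :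
    (1 - ε) * (Fintype.card F : ℝ) ^ t.choose 2 ≤ numSolvable F t A := by
  have hA' : (0 : ℝ) < #A := by exact_mod_cast hA.card_pos
  have h0 : 0 < 2 / η := by positivity
  set q := (Fintype.card F : ℝ)
  have h1 := abs_card_constrainedTuples_sub_le (A := A ×ˢ A) (hA.product hA) (t := t)
    (R := fun (_ : IndexPair t) x y => Algebra.norm F (x.1 + y.1) = Algebra.norm F (x.2 + y.2))
    (q := q) (δ := 1 / (q - 1)) (Λ := 4 * Fintype.card K) (η := η) (by linarith) (by positivity)
    (one_div_nonneg.2 (by linarith)) (abs_one_div_sub_one_mul_sub_one_le hη hq)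
    (by rw [card_product]; push_cast; rw [← sq]; exact hcard) univ
    (fun _ _ U W => abs_sum_norm_add_eq_norm_add_sub_le U W)
  rw [card_univ, card_indexPair] at h1
  have h2 := le_mul_of_abs_sub_le h1
  have h3 := sq_card_le_card_image_mul (Fintype.piFinset fun _ : Fin t => A) (pairNorms F)
  rw [← numSolvable_eq, card_pairNorms_eq] at h3
  set T := (numSolvable F t A : ℝ)
  set b := t.choose 2
  have hq0 : 0 < q := by linarith
  have hT : 0 ≤ T := by positivity
  have h4 := h3.trans (mul_le_mul_of_nonneg_left h2 hT)
  simp only [Fintype.card_piFinset, prod_const, card_univ, Fintype.card_fin, card_product] at h4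
  push_cast at h4
  rw [← sq, pow_right_comm _ 2 t] at h4
  have hB : (0 : ℝ) < ((#A : ℝ) ^ t) ^ 2 := by positivity
  have h5 : q ^ b ≤ T * (1 + η) ^ b := by
    refine le_of_mul_le_mul_left ?_ hB
    calc ((#A : ℝ) ^ t) ^ 2 * q ^ b ≤ T * ((1 + η) ^ b * (((#A : ℝ) ^ t) ^ 2 / q ^ b)) * q ^ b := by
          gcongr
      _ = _ := by field_simp
  have h6 : q ^ b ≤ T * (1 + ε) := h5.trans (by gcongr; linarith)
  have hqb : 0 < q ^ b := by positivity
  refine le_of_mul_le_mul_right ?_ (show 0 < 1 + ε by linarith)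
  nlinarith [mul_pos (mul_pos hε hε) hqb]

lemma abs_numSolutions_sub_le [Fintype F] [Fintype K] {A : Finset K} (hA : A.Nonempty) {η : ℝ}
    (hη : 0 < η) (hq : 2 / η + 2 ≤ (Fintype.card F : ℝ))
    (hcard : √(Fintype.card K : ℝ) * (Fintype.card F : ℝ) ^ t ≤ η / 2 * (#A * Fintype.card F))
    (S : Finset (IndexPair t)) {lam : IndexPair t → F} (hlam : ∀ p ∈ S, lam p ≠ 0) :
    |(numSolutions F A S lam : ℝ) - (#A : ℝ) ^ t / (Fintype.card F : ℝ) ^ #S| ≤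
      ((1 + η) ^ #S - 1) * ((#A : ℝ) ^ t / (Fintype.card F : ℝ) ^ #S) := by
  have h0 : 0 < 2 / η := by positivity
  rw [numSolutions_eq]
  exact abs_card_constrainedTuples_sub_le hA (by linarith) (by positivity)
    (one_div_nonneg.2 (by linarith)) (abs_one_div_sub_one_mul_sub_one_le hη hq) hcard S
    (fun p hp U W => abs_sum_norm_add_eq_sub_le (hlam p hp) U W)

end NormSystems

/-! ### Choice of constants. -/

theorem mainTheorem10 :
    (∀ (t : ℕ) (ε : ℝ), 0 < ε → ∃ (C : ℝ) (q₀ : ℕ), 0 < C ∧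
      ∀ (F : Type u) (K : Type v) [Field F] [Finite F] [Field K] [Algebra F K] (q n : ℕ),
        Nat.card F = q → Module.finrank F K = n → q₀ ≤ q → 2 ≤ n →
        ∀ A : Finset K, C * (q : ℝ) ^ (((n : ℝ) + (t : ℝ)) / 2) ≤ (A.card : ℝ) →
          (1 - ε) * (q : ℝ) ^ (t.choose 2) ≤ (numSolvable F t A : ℝ)) ∧
    (∀ (t : ℕ) (ε : ℝ), 0 < ε → ∃ (C : ℝ) (q₀ : ℕ), 0 < C ∧
      ∀ (F : Type u) (K : Type v) [Field F] [Finite F] [Field K] [Algebra F K] (q n : ℕ),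
        Nat.card F = q → Module.finrank F K = n → q₀ ≤ q → 2 ≤ n →
        ∀ (S : Finset (IndexPair t)) (k l : ℕ), k ≤ t - 1 → (∀ i, occurrences S i ≤ k) →
          S.card = l →
        ∀ A : Finset K, C * (q : ℝ) ^ ((n : ℝ) / 2 + (t : ℝ) - 1) ≤ (A.card : ℝ) →
        ∀ lam : IndexPair t → F, (∀ p ∈ S, lam p ≠ 0) →
          |(numSolutions F A S lam : ℝ) - (A.card : ℝ) ^ t / (q : ℝ) ^ l| ≤
            ε * ((A.card : ℝ) ^ t / (q : ℝ) ^ l)) := by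
  constructor
  · intro t ε hε
    obtain ⟨η, hη, hpow⟩ := exists_one_add_pow_sub_one_le (t.choose 2) hε
    -- The ratio 8/η comes from Λ = 4q^n against η/2. The size of A enters squared, and adding 1
    -- ensures 8/η ≤ C². The threshold on q makes 1/(q - 1) ≤ η/2.
    refine ⟨1 + 8 / η, ⌈2 / η + 2⌉₊, by positivity, ?_⟩
    intro F K _ _ _ _ q n hFq hKn hq hn A hA
    have : Module.Finite F K := Module.finite_of_finrank_pos (by omega)
    have : Finite K := Module.finite_of_finite F
    have : Fintype F := Fintype.ofFinite F
    have : Fintype K := Fintype.ofFinite K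
    rw [Nat.card_eq_fintype_card] at hFq
    have hK : Fintype.card K = q ^ n := by rw [Module.card_eq_pow_finrank (K := F), hFq, hKn]
    have hq2 : 2 / η + 2 ≤ (q : ℝ) := Nat.ceil_le.1 hq
    have h0 : 0 < 2 / η := by positivity
    have hq0 : (0 : ℝ) < q := by linarith
    have hApos : (0 : ℝ) < A.card := lt_of_lt_of_le (by positivity) hA
    have hAne : A.Nonempty := Finset.card_pos.1 (by exact_mod_cast hApos)
    subst hFq
    refine numSolvable_ge hAne hε hη (hpow _ le_rfl) hq2 ?_
    set q := (Fintype.card F : ℝ)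
    have hsq : (1 + 8 / η) ^ 2 * (q ^ n * q ^ t) ≤ (A.card : ℝ) ^ 2 := by
      have h1 := pow_le_pow_left₀ (by positivity) hA 2
      rw [mul_pow, ← Real.rpow_natCast (q ^ _) 2, ← Real.rpow_mul hq0.le] at h1
      rw [← pow_add, ← Real.rpow_natCast q (n + t)]
      rw [show ((n + t : ℕ) : ℝ) = ((n : ℝ) + t) / 2 * (2 : ℕ) by push_cast; ring]
      exact h1
    have hC : 8 / η ≤ (1 + 8 / η) ^ 2 := by
      have : 0 < 8 / η := by positivity
      nlinarith
    rw [hK]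
    push_cast
    -- Only |A|² ≫ q^(n+t-1) is needed here, so a factor q is given away.
    calc 4 * q ^ n * q ^ t = η / 2 * (8 / η * (q ^ n * q ^ t) * 1) := by field_simp; norm_num
      _ ≤ η / 2 * ((1 + 8 / η) ^ 2 * (q ^ n * q ^ t) * q) := by
          gcongr
          linarith
      _ ≤ _ := by gcongr
  · intro t ε hε
    obtain ⟨η, hη, hpow⟩ := exists_one_add_pow_sub_one_le (t.choose 2) hε
    -- With Λ = q^(n/2) this C gives exactly Λ q^(t-1) ≤ (η/2)|A|.
    refine ⟨2 / η, ⌈2 / η + 2⌉₊, by positivity, ?_⟩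
    intro F K _ _ _ _ q n hFq hKn hq hn S k l _ _ hl A hA lam hlam
    have : Module.Finite F K := Module.finite_of_finrank_pos (by omega)
    have : Finite K := Module.finite_of_finite F
    have : Fintype F := Fintype.ofFinite F
    have : Fintype K := Fintype.ofFinite K
    rw [Nat.card_eq_fintype_card] at hFq
    have hK : Fintype.card K = q ^ n := by rw [Module.card_eq_pow_finrank (K := F), hFq, hKn]
    have hq2 : 2 / η + 2 ≤ (q : ℝ) := Nat.ceil_le.1 hq
    have h0 : 0 < 2 / η := by positivity
    have hq0 : (0 : ℝ) < q := by linarith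
    have hApos : (0 : ℝ) < A.card := lt_of_lt_of_le (by positivity) hA
    have hAne : A.Nonempty := Finset.card_pos.1 (by exact_mod_cast hApos)
    subst hFq hl
    have hS : S.card ≤ t.choose 2 := (Finset.card_le_univ S).trans (card_indexPair t).le
    refine (abs_numSolutions_sub_le hAne hη hq2 ?_ S hlam).trans
      (mul_le_mul_of_nonneg_right (hpow _ hS) (by positivity))
    set q := (Fintype.card F : ℝ)
    have hsqrt : √(Fintype.card K : ℝ) * q ^ t = q ^ ((n : ℝ) / 2 + (t : ℝ) - 1) * q := by
      rw [hK]
      push_cast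
      rw [Real.sqrt_eq_rpow, ← Real.rpow_natCast q t, ← Real.rpow_natCast (Fintype.card F : ℝ) n,
        ← Real.rpow_mul hq0.le, ← Real.rpow_add hq0, ← Real.rpow_add_one hq0.ne']
      congr 1
      ring
    rw [hsqrt]
    calc q ^ ((n : ℝ) / 2 + (t : ℝ) - 1) * q
        = η / 2 * (2 / η * q ^ ((n : ℝ) / 2 + (t : ℝ) - 1) * q) := by field_simp
      _ ≤ _ := by gcongr
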